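/- For a partition $\pi$ (a finite multiset of positive integers, possibly empty) let $m(\pi)$ denote the number of parts of $\pi$ plus the number of even parts of $\pi$. A Schur partition is a partition in which consecutive parts differ by at least $3$ and no two consecutive multiples of $3$ (that is, $3k$ and $3k+3$ for some $k$) both occur as parts. For integers $m,n$ let $\mathcal{D}(m,n)$ be the set of Schur partitions $\pi$ of $n$ with $m(\pi)=m$, and let $\mathcal{D}^*(m,n)$ be the set of those $\pi\in\mathcal{D}(m,n)$ in which every odd part is $\ge 3$ and every even part is $\ge 6$. Let $\mathcal{C}(m,n)$ be the set of partitions of $n$ into $m$ odd parts, each occurring at most twice, and let $\mathcal{C}^*(m,n)$ be the set of those $\pi\in\mathcal{C}(m,n)$ in which every part is $>1$. (All these sets are empty if $m<0$ or $n<0$.) Then, for all integers $m,n$, $$|\mathcal{D}^*(m,n)|=|\mathcal{C}^*(m,n)|,$$ and consequently $$|\mathcal{D}^*(m,n)|=|\mathcal{D}(m,n-2m)|.$$ -/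

import Mathlib

/-- An integer partition, that is, a partition of some natural number `k`
(the empty partition is the partition of `0`). -/
abbrev IntPartition : Type := Σ k : ℕ, Nat.Partition k

namespace IntPartition

/-- `m(π)`: the number of parts of `π` plus the number of even parts of `π`. -/
def weight (π : IntPartition) : ℕ :=
  π.2.parts.card + (π.2.parts.filter (fun a => Even a)).card

/-- Schur partitions: the gap between consecutive parts is at least `3` (equivalently, no part is
repeated and any two different parts differ by at least `3`), and no two consecutive multiples
`3 * k`, `3 * k + 3` of `3` both occur as parts. -/
def IsSchur (π : IntPartition) : Prop :=
  π.2.parts.Nodup ∧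
  (∀ a ∈ π.2.parts, ∀ b ∈ π.2.parts, a < b → a + 3 ≤ b) ∧
  ∀ k : ℕ, ¬ (3 * k ∈ π.2.parts ∧ 3 * k + 3 ∈ π.2.parts)

/-- Alladi partitions: all parts are odd and every part occurs at most twice. -/
def IsAlladi (π : IntPartition) : Prop :=
  (∀ a ∈ π.2.parts, Odd a) ∧ ∀ a : ℕ, π.2.parts.count a ≤ 2

end IntPartition

/-- `𝒟(m, n)`: the Schur partitions `π` of `n` with `m(π) = m`. The indices are integers; the set
is empty if one of them is negative. -/
def schurD (m n : ℤ) : Set IntPartition :=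
  {π | (π.1 : ℤ) = n ∧ π.IsSchur ∧ (π.weight : ℤ) = m}

/-- `𝒟*(m, n)`: the members of `𝒟(m, n)` whose odd parts are at least `3` and whose even parts
are at least `6`. -/
def schurDStar (m n : ℤ) : Set IntPartition :=
  {π | π ∈ schurD m n ∧ (∀ a ∈ π.2.parts, Odd a → 3 ≤ a) ∧ ∀ a ∈ π.2.parts, Even a → 6 ≤ a}

/-- `𝒞(m, n)`: the partitions of `n` into `m` odd parts, each occurring at most twice. -/
def alladiC (m n : ℤ) : Set IntPartition :=
  {π | (π.1 : ℤ) = n ∧ π.IsAlladi ∧ (π.2.parts.card : ℤ) = m}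

/-- `𝒞*(m, n)`: the members of `𝒞(m, n)` all of whose parts are greater than `1`. -/
def alladiCStar (m n : ℤ) : Set IntPartition :=
  {π | π ∈ alladiC m n ∧ ∀ a ∈ π.2.parts, 1 < a}

/-! Both families obey the same two relations, and these determine the counts by induction on `n`.
Writing D, D* for the counts on the Schur side, the relations are D*(m, n) = D(m, n - 2m) and D(m,
n) = D*(m, n) + D*(m-1, n-1) + D*(m-2, n-2). On the odd-part side they are immediate: add 2 to every
part, and sort by the number of ones. On the Schur side they come from polynomials counting
partitions with parts at most N, which satisfy a recurrence in N. `schurGenFun_eq_mul_star` extracts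
the factor 1 + xq + x²q², and `schurGenFun_shift_and` realises the shift as the substitution x ↦
xq². Comparing coefficients gives the two relations, and `encard_schurD_eq_oddMultisets` runs the
induction. -/

/-- The Schur gap conditions on a finite set of parts. -/
def IsSchurFinset (s : Finset ℕ) : Prop :=
  (∀ a ∈ s, ∀ b ∈ s, a < b → a + 3 ≤ b) ∧ ∀ k : ℕ, ¬ (3 * k ∈ s ∧ 3 * k + 3 ∈ s)

open Classical in
/-- The part sets of Schur partitions with all parts at most `N`. -/
noncomputable def schurFinsets (N : ℕ) : Finset (Finset ℕ) :=
  (Finset.Icc 1 N).powerset.filter IsSchurFinset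

theorem mem_schurFinsets {N : ℕ} {s : Finset ℕ} :
    s ∈ schurFinsets N ↔ (∀ a ∈ s, 1 ≤ a ∧ a ≤ N) ∧ IsSchurFinset s := by
  simp [schurFinsets, Finset.subset_iff]

/-- The generating function of Schur partitions with parts at most `N`, a part `j` having
weight `c j`. -/
noncomputable def schurGenFun {R : Type*} [CommSemiring R] (c : ℕ → R) (N : ℕ) : R :=
  ∑ s ∈ schurFinsets N, ∏ j ∈ s, c j

theorem IsSchurFinset.mono {s t : Finset ℕ} (h : IsSchurFinset t) (hst : s ⊆ t) :
    IsSchurFinset s :=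
  ⟨fun a ha b hb => h.1 a (hst ha) b (hst hb), fun k hk => h.2 k ⟨hst hk.1, hst hk.2⟩⟩

/-- The largest part that may precede the part `N`. -/
def schurPrev (N : ℕ) : ℕ := if 3 ∣ N then N - 4 else N - 3

/-- Split on whether `N + 1` is a part. If it is, `schurPrev` bounds the remaining parts, and this
bound alone restores both Schur conditions. A truncated bound 0 leaves only the empty set. -/
theorem schurFinsets_succ (N : ℕ) :
    schurFinsets (N + 1) =
      schurFinsets N ∪ (schurFinsets (schurPrev (N + 1))).image (insert (N + 1)) := by
  ext s
  simp only [Finset.mem_union, Finset.mem_image, mem_schurFinsets]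
  constructor
  · rintro ⟨h1, h2⟩
    by_cases hN : N + 1 ∈ s
    · refine Or.inr ⟨s.erase (N + 1), ⟨?_, h2.mono (Finset.erase_subset _ _)⟩,
        Finset.insert_erase hN⟩
      intro a ha
      obtain ⟨ha1, ha2⟩ := Finset.mem_erase.1 ha
      have h3 := h1 a ha2
      have h4 := h2.1 a ha2 _ hN (by omega)
      refine ⟨h3.1, ?_⟩
      unfold schurPrev
      split_ifs with hd
      · obtain ⟨k, hk⟩ := hd
        -- A gap of exactly 3 below a multiple of 3 would give two consecutive multiples of 3.
        by_contra hlt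
        apply h2.2 (k - 1)
        rw [show 3 * (k - 1) = a by omega, show a + 3 = N + 1 by omega]
        exact ⟨ha2, hN⟩
      · omega
    · refine Or.inl ⟨fun a ha => ?_, h2⟩
      have h3 := h1 a ha
      have : a ≠ N + 1 := fun h => hN (h ▸ ha)
      omega
  · rintro (⟨h1, h2⟩ | ⟨t, ⟨h1, h2⟩, rfl⟩)
    · exact ⟨fun a ha => ⟨(h1 a ha).1, by have := (h1 a ha).2; omega⟩, h2⟩
    · have hprev : ∀ a ∈ t, 1 ≤ a ∧ a + 3 ≤ N + 1 ∧ (3 ∣ N + 1 → a + 4 ≤ N + 1) := by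
        intro a ha
        have h3 := h1 a ha
        unfold schurPrev at h3
        split_ifs at h3 <;> omega
      refine ⟨?_, ?_, ?_⟩
      · intro a ha
        rcases Finset.mem_insert.1 ha with rfl | ha
        · omega
        · have := hprev a ha
          omega
      · intro a ha b hb hab
        rcases Finset.mem_insert.1 ha with rfl | ha <;> rcases Finset.mem_insert.1 hb with rfl | hb
        · omega
        · have := hprev b hb
          omega
        · have := hprev a ha
          omega
        · exact h2.1 a ha b hb hab
      · rintro k ⟨ha, hb⟩
        rcases Finset.mem_insert.1 ha with ha | ha <;> rcases Finset.mem_insert.1 hb with hb | hb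
        · omega
        · have := hprev _ hb
          omega
        · have := hprev _ ha
          omega
        · exact h2.2 k ⟨ha, hb⟩

/-! ### Recurrence for the bounded generating functions -/

section Recurrence

variable {R : Type*} [CommSemiring R] (c : ℕ → R)

theorem schurGenFun_zero : schurGenFun c 0 = 1 := by
  have : schurFinsets 0 = {∅} := by
    ext s
    simp only [mem_schurFinsets, Finset.mem_singleton]
    constructor
    · rintro ⟨h, -⟩
      refine Finset.eq_empty_of_forall_notMem fun a ha => ?_
      have := h a ha
      omega
    · rintro rfl
      simp [IsSchurFinset]
  simp [schurGenFun, this]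

theorem schurGenFun_succ (N : ℕ) :
    schurGenFun c (N + 1) =
      schurGenFun c N + c (N + 1) * schurGenFun c (schurPrev (N + 1)) := by
  have hprev : schurPrev (N + 1) ≤ N := by
    unfold schurPrev
    split_ifs <;> omega
  have hnot : ∀ M ≤ N, ∀ s ∈ schurFinsets M, N + 1 ∉ s := by
    intro M hM s hs hN
    have := (mem_schurFinsets.1 hs).1 _ hN
    omega
  unfold schurGenFun
  rw [schurFinsets_succ, Finset.sum_union, Finset.sum_image, Finset.mul_sum]
  · congr 1
    exact Finset.sum_congr rfl fun s hs => Finset.prod_insert (hnot _ hprev s hs)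
  · intro s hs t ht hst
    rw [← Finset.erase_insert (hnot _ hprev s hs), ← Finset.erase_insert (hnot _ hprev t ht), hst]
  · rw [Finset.disjoint_left]
    intro s hs hs'
    obtain ⟨t, -, rfl⟩ := Finset.mem_image.1 hs'
    exact hnot N le_rfl _ hs (Finset.mem_insert_self _ _)

theorem schurGenFun_of_dvd {N : ℕ} (h : 3 ∣ N + 1) :
    schurGenFun c (N + 1) = schurGenFun c N + c (N + 1) * schurGenFun c (N - 3) := by
  rw [schurGenFun_succ, schurPrev, if_pos h]
  rfl

theorem schurGenFun_of_not_dvd {N : ℕ} (h : ¬ 3 ∣ N + 1) :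
    schurGenFun c (N + 1) = schurGenFun c N + c (N + 1) * schurGenFun c (N - 2) := by
  rw [schurGenFun_succ, schurPrev, if_neg h]
  rfl

end Recurrence

/-! ### The two polynomial identities -/

/-- The contribution of a part to `m(π)`. -/
def partWeight (j : ℕ) : ℕ := if Even j then 2 else 1

/-- The parts allowed in `𝒟*(m, n)`. -/
def IsStarPart (j : ℕ) : Prop := j ≠ 1 ∧ j ≠ 2 ∧ j ≠ 4

instance : DecidablePred IsStarPart := fun _ => inferInstanceAs (Decidable (_ ∧ _ ∧ _))

section Identities

variable {R : Type*} [CommSemiring R] (x q : R)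

/-- The weight `x ^ w(j) * q ^ j` of a part `j`, where `w(j)` is its contribution to `m(π)`. -/
def schurMonomial (j : ℕ) : R := x ^ partWeight j * q ^ j

/-- The weight of a part `j`, zero for the parts that are not allowed in `𝒟*(m, n)`. -/
def starMonomial (j : ℕ) : R := if IsStarPart j then schurMonomial x q j else 0

theorem schurMonomial_even {j : ℕ} (h : j % 2 = 0) : schurMonomial x q j = x ^ 2 * q ^ j := by
  rw [schurMonomial, partWeight, if_pos (Nat.even_iff.2 h)]

theorem schurMonomial_odd {j : ℕ} (h : j % 2 = 1) : schurMonomial x q j = x * q ^ j := by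
  rw [schurMonomial, partWeight, if_neg (Nat.not_even_iff.2 h), pow_one]

theorem starMonomial_of_five_le {j : ℕ} (h : 5 ≤ j) :
    starMonomial x q j = schurMonomial x q j :=
  if_pos ⟨by omega, by omega, by omega⟩

/-- From 7 on, both sides satisfy one recurrence: the weights agree from 5 on and `schurPrev` stays
at least 4. Only N = 4, 5, 6 need computation. -/
theorem schurGenFun_eq_mul_star (N : ℕ) (hN : 4 ≤ N) :
    schurGenFun (schurMonomial x q) N =
      (1 + x * q + x ^ 2 * q ^ 2) * schurGenFun (starMonomial x q) N := by
  induction N using Nat.strong_induction_on with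
  | _ N ih =>
    by_cases h7 : 7 ≤ N
    · obtain ⟨M, rfl⟩ : ∃ M, N = M + 1 := ⟨N - 1, by omega⟩
      have hp : 4 ≤ schurPrev (M + 1) ∧ schurPrev (M + 1) < M + 1 := by
        unfold schurPrev
        split_ifs <;> omega
      rw [schurGenFun_succ, schurGenFun_succ, ih M (by omega) (by omega), ih _ hp.2 hp.1,
        starMonomial_of_five_le _ _ (by omega)]
      ring
    · interval_cases N <;>
        simp [schurGenFun_succ, schurPrev, schurGenFun_zero, starMonomial, IsStarPart,
          schurMonomial, partWeight, Nat.even_iff] <;> ring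

/-- Under x ↦ xq², odd parts grow by 2 and even parts by 4, which gives exactly the star parts, but
gaps are not preserved. The generating functions are therefore matched at selected cutoffs; the
second equation is carried along so that the six-step recurrence closes. -/
theorem schurGenFun_shift_and (n : ℕ) :
    schurGenFun (schurMonomial (x * q ^ 2) q) (6 * n - 1) =
        schurGenFun (starMonomial x q) (6 * n + 2) ∧
      schurGenFun (schurMonomial (x * q ^ 2) q) (6 * n + 1) =
        schurGenFun (starMonomial x q) (6 * n + 4) := by
  induction n with
  | zero =>
    -- Here `6 * 0 - 1` truncates to 0, and both sides of the first equation are 1.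
    simp [schurGenFun_succ, schurPrev, schurGenFun_zero, starMonomial, IsStarPart,
      schurMonomial, partWeight, Nat.even_iff]
    ring
  | succ n ih =>
    obtain ⟨ih1, ih2⟩ := ih
    set a := schurGenFun (schurMonomial (x * q ^ 2) q) with ha
    set s := schurGenFun (starMonomial x q) with hs
    have a2 : a (6 * n + 2) = a (6 * n + 1) + (x * q ^ 2) ^ 2 * q ^ (6 * n + 2) * a (6 * n - 1) := by
      rw [ha, schurGenFun_of_not_dvd _ (by omega), schurMonomial_even _ _ (by omega)]
      rfl
    have a3 : a (6 * n + 3) = a (6 * n + 2) + (x * q ^ 2) * q ^ (6 * n + 3) * a (6 * n - 1) := by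
      rw [ha, schurGenFun_of_dvd _ (by omega), schurMonomial_odd _ _ (by omega)]
      rfl
    have a4 : a (6 * n + 4) = a (6 * n + 3) + (x * q ^ 2) ^ 2 * q ^ (6 * n + 4) * a (6 * n + 1) := by
      rw [ha, schurGenFun_of_not_dvd _ (by omega), schurMonomial_even _ _ (by omega)]
      rfl
    have a5 : a (6 * n + 5) = a (6 * n + 4) + (x * q ^ 2) * q ^ (6 * n + 5) * a (6 * n + 2) := by
      rw [ha, schurGenFun_of_not_dvd _ (by omega), schurMonomial_odd _ _ (by omega)]
      rfl
    have a6 : a (6 * n + 6) = a (6 * n + 5) + (x * q ^ 2) ^ 2 * q ^ (6 * n + 6) * a (6 * n + 2) := by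
      rw [ha, schurGenFun_of_dvd _ (by omega), schurMonomial_even _ _ (by omega)]
      rfl
    have a7 : a (6 * n + 7) = a (6 * n + 6) + (x * q ^ 2) * q ^ (6 * n + 7) * a (6 * n + 4) := by
      rw [ha, schurGenFun_of_not_dvd _ (by omega), schurMonomial_odd _ _ (by omega)]
      rfl
    have s5 : s (6 * n + 5) = s (6 * n + 4) + x * q ^ (6 * n + 5) * s (6 * n + 2) := by
      rw [hs, schurGenFun_of_not_dvd _ (by omega), starMonomial_of_five_le _ _ (by omega),
        schurMonomial_odd _ _ (by omega)]
      rfl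
    have s6 : s (6 * n + 6) = s (6 * n + 5) + x ^ 2 * q ^ (6 * n + 6) * s (6 * n + 2) := by
      rw [hs, schurGenFun_of_dvd _ (by omega), starMonomial_of_five_le _ _ (by omega),
        schurMonomial_even _ _ (by omega)]
      rfl
    have s7 : s (6 * n + 7) = s (6 * n + 6) + x * q ^ (6 * n + 7) * s (6 * n + 4) := by
      rw [hs, schurGenFun_of_not_dvd _ (by omega), starMonomial_of_five_le _ _ (by omega),
        schurMonomial_odd _ _ (by omega)]
      rfl
    have s8 : s (6 * n + 8) = s (6 * n + 7) + x ^ 2 * q ^ (6 * n + 8) * s (6 * n + 5) := by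
      rw [hs, schurGenFun_of_not_dvd _ (by omega), starMonomial_of_five_le _ _ (by omega),
        schurMonomial_even _ _ (by omega)]
      rfl
    have s9 : s (6 * n + 9) = s (6 * n + 8) + x * q ^ (6 * n + 9) * s (6 * n + 5) := by
      rw [hs, schurGenFun_of_dvd _ (by omega), starMonomial_of_five_le _ _ (by omega),
        schurMonomial_odd _ _ (by omega)]
      rfl
    have s10 : s (6 * n + 10) = s (6 * n + 9) + x ^ 2 * q ^ (6 * n + 10) * s (6 * n + 7) := by
      rw [hs, schurGenFun_of_not_dvd _ (by omega), starMonomial_of_five_le _ _ (by omega),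
        schurMonomial_even _ _ (by omega)]
      rfl
    rw [show 6 * (n + 1) - 1 = 6 * n + 5 by omega, show 6 * (n + 1) + 2 = 6 * n + 8 by ring,
      show 6 * (n + 1) + 1 = 6 * n + 7 by ring, show 6 * (n + 1) + 4 = 6 * n + 10 by ring]
    constructor
    · rw [a5, a4, a3, a2, s8, s7, s6, s5, ih1, ih2]
      ring
    · rw [a7, a6, a5, a4, a3, a2, s10, s9, s8, s7, s6, s5, ih1, ih2]
      ring

end Identities

/-! ### Coefficient extraction -/

section Counting

open Classical in
/-- The members of `schurFinsets N` consisting of parts satisfying `Q`, with prescribed weight and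
sum. -/
noncomputable def schurCount (Q : ℕ → Prop) (N : ℕ) (m n : ℤ) : ℕ :=
  ((schurFinsets N).filter fun s =>
    (∀ j ∈ s, Q j) ∧ ∑ j ∈ s, (partWeight j : ℤ) = m ∧ ∑ j ∈ s, (j : ℤ) = n).card

/-- The parameter `d` encodes x ↦ xq^d, which moves the second index by `d * m`. Integer exponents
allow negative indices. -/
theorem coeff_schurGenFun (Q : ℕ → Prop) [DecidablePred Q] (N : ℕ) (d m n : ℤ) :
    (schurGenFun (fun j => if Q j then
        AddMonoidAlgebra.single ((partWeight j : ℤ), (j : ℤ) + d * partWeight j) (1 : ℕ) else 0)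
      N).coeff (m, n) = schurCount Q N m (n - d * m) := by
  classical
  rw [schurGenFun, AddMonoidAlgebra.coeff_sum, Finsupp.finsetSum_apply, schurCount,
    Finset.card_filter]
  refine Finset.sum_congr rfl fun s _ => ?_
  by_cases hQ : ∀ j ∈ s, Q j
  · rw [Finset.prod_congr rfl fun j hj => if_pos (hQ j hj), AddMonoidAlgebra.prod_single,
      AddMonoidAlgebra.coeff_single, Finsupp.single_apply]
    simp only [Finset.prod_const_one, Prod.ext_iff, Prod.fst_sum, Prod.snd_sum,
      Finset.sum_add_distrib, ← Finset.mul_sum]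
    split_ifs with h1 h2 h2
    · rfl
    · obtain ⟨h1, h3⟩ := h1
      rw [h1] at h3
      exact absurd ⟨hQ, h1, by linarith⟩ h2
    · obtain ⟨-, h2, h3⟩ := h2
      refine absurd ⟨h2, ?_⟩ h1
      rw [h2]
      linarith
    · rfl
  · rw [if_neg fun h => hQ h.1]
    push Not at hQ
    obtain ⟨j, hj, hjQ⟩ := hQ
    rw [Finset.prod_eq_zero hj (if_neg hjQ)]
    rfl

theorem schurMonomial_single (d : ℕ) (j : ℕ) :
    schurMonomial (AddMonoidAlgebra.single ((1 : ℤ), (0 : ℤ)) (1 : ℕ) *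
        AddMonoidAlgebra.single ((0 : ℤ), (1 : ℤ)) (1 : ℕ) ^ d)
      (AddMonoidAlgebra.single ((0 : ℤ), (1 : ℤ)) (1 : ℕ)) j =
    AddMonoidAlgebra.single ((partWeight j : ℤ), (j : ℤ) + d * partWeight j) 1 := by
  simp [schurMonomial, AddMonoidAlgebra.single_pow, AddMonoidAlgebra.single_mul_single]
  congr 2
  ring

theorem coeff_schurGenFun_schurMonomial (N d : ℕ) (m n : ℤ) :
    (schurGenFun (schurMonomial (AddMonoidAlgebra.single ((1 : ℤ), (0 : ℤ)) (1 : ℕ) *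
        AddMonoidAlgebra.single ((0 : ℤ), (1 : ℤ)) (1 : ℕ) ^ d)
      (AddMonoidAlgebra.single ((0 : ℤ), (1 : ℤ)) (1 : ℕ))) N).coeff (m, n) =
    schurCount (fun _ => True) N m (n - d * m) := by
  rw [← coeff_schurGenFun]
  congr 3
  funext j
  rw [schurMonomial_single, if_pos trivial]

theorem coeff_schurGenFun_starMonomial (N : ℕ) (m n : ℤ) :
    (schurGenFun (starMonomial (AddMonoidAlgebra.single ((1 : ℤ), (0 : ℤ)) (1 : ℕ))
      (AddMonoidAlgebra.single ((0 : ℤ), (1 : ℤ)) (1 : ℕ))) N).coeff (m, n) =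
    schurCount IsStarPart N m n := by
  have h := coeff_schurGenFun IsStarPart N 0 m n
  rw [zero_mul, sub_zero] at h
  rw [← h]
  congr 3
  funext j
  have h1 := schurMonomial_single 0 j
  rw [pow_zero, mul_one] at h1
  rw [starMonomial, h1]
  rfl

theorem schurCount_eq_star_add (N : ℕ) (hN : 4 ≤ N) (m n : ℤ) :
    schurCount (fun _ => True) N m n =
      schurCount IsStarPart N m n + schurCount IsStarPart N (m - 1) (n - 1) +
        schurCount IsStarPart N (m - 2) (n - 2) := by
  have h := congrArg (fun f => AddMonoidAlgebra.coeff f (m, n)) (schurGenFun_eq_mul_star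
    (AddMonoidAlgebra.single ((1 : ℤ), (0 : ℤ)) (1 : ℕ))
    (AddMonoidAlgebra.single ((0 : ℤ), (1 : ℤ)) (1 : ℕ)) N hN)
  have h1 := coeff_schurGenFun_schurMonomial N 0 m n
  simp only [pow_zero, mul_one, Nat.cast_zero, zero_mul, sub_zero] at h1
  simp only [h1, add_mul, one_mul, AddMonoidAlgebra.single_pow,
    AddMonoidAlgebra.single_mul_single, AddMonoidAlgebra.coeff_add, Finsupp.add_apply,
    AddMonoidAlgebra.coeff_single_mul_apply, one_pow] at h
  rw [h, ← coeff_schurGenFun_starMonomial, ← coeff_schurGenFun_starMonomial,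
    ← coeff_schurGenFun_starMonomial]
  congr 3
  · simp [sub_eq_neg_add]
  · simp [sub_eq_neg_add]

theorem schurCount_star_eq (k : ℕ) (m n : ℤ) :
    schurCount IsStarPart (6 * k + 2) m n =
      schurCount (fun _ => True) (6 * k - 1) m (n - 2 * m) := by
  rw [← coeff_schurGenFun_starMonomial, ← (schurGenFun_shift_and _ _ k).1]
  exact coeff_schurGenFun_schurMonomial (6 * k - 1) 2 m n

end Counting

/-! ### From part sets to partitions -/

namespace IntPartition

theorem parts_injective : Function.Injective fun π : IntPartition => π.2.parts := by
  rintro ⟨k, p⟩ ⟨l, p'⟩ h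
  have hkl : k = l := by
    rw [← p.parts_sum, ← p'.parts_sum]
    exact congrArg Multiset.sum h
  subst hkl
  exact congrArg _ (Nat.Partition.ext h)

/-- The partition with a given multiset of positive parts. -/
def ofMultiset (t : Multiset ℕ) (h : ∀ a ∈ t, 0 < a) : IntPartition :=
  ⟨t.sum, ⟨t, fun {a} ha => h a ha, rfl⟩⟩

end IntPartition

/-- No part exceeds `n`, so a cutoff `N ≥ n` excludes nothing. -/
theorem encard_schurD_sep (Q : ℕ → Prop) (m n : ℤ) (N : ℕ) (hN : n ≤ N) :
    {π | π ∈ schurD m n ∧ ∀ a ∈ π.2.parts, Q a}.encard = schurCount Q N m n := by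
  classical
  have hinj : Set.InjOn (fun π : IntPartition => π.2.parts.toFinset)
      {π | π ∈ schurD m n ∧ ∀ a ∈ π.2.parts, Q a} := by
    rintro π ⟨⟨-, ⟨hπ, -⟩, -⟩, -⟩ π' ⟨⟨-, ⟨hπ', -⟩, -⟩, -⟩ h
    apply IntPartition.parts_injective
    have h' := congrArg Finset.val h
    simpa only [Multiset.toFinset_val, hπ.dedup, hπ'.dedup] using h'
  have hweight : ∀ s : Finset ℕ,
      ∑ j ∈ s, (partWeight j : ℤ) = s.card + (s.filter fun a => Even a).card := by
    intro s
    rw [Finset.card_filter, Finset.card_eq_sum_ones]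
    push_cast
    rw [← Finset.sum_add_distrib]
    refine Finset.sum_congr rfl fun j _ => ?_
    unfold partWeight
    split_ifs <;> norm_num
  rw [← hinj.encard_image, schurCount, ← Set.encard_coe_eq_coe_finsetCard]
  congr 1
  ext s
  simp only [Set.mem_image, Finset.coe_filter, Set.mem_ofPred_eq, mem_schurFinsets]
  constructor
  · rintro ⟨π, ⟨⟨hn, ⟨hnd, hgap, hmul⟩, hm⟩, hQ⟩, rfl⟩
    have hval : π.2.parts.toFinset.val = π.2.parts := by
      rw [Multiset.toFinset_val, hnd.dedup]
    have hsum : ∑ j ∈ π.2.parts.toFinset, j = π.1 := by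
      rw [Finset.sum_eq_multiset_sum, hval, Multiset.map_id', π.2.parts_sum]
    refine ⟨⟨?_, ?_⟩, ?_, ?_, ?_⟩
    · intro a ha
      have hle := Finset.single_le_sum (f := fun j : ℕ => j) (fun _ _ => Nat.zero_le _) ha
      rw [hsum] at hle
      exact ⟨π.2.parts_pos (Multiset.mem_toFinset.1 ha), by omega⟩
    · exact ⟨fun a ha b hb => hgap a (Multiset.mem_toFinset.1 ha) b (Multiset.mem_toFinset.1 hb),
        fun k hk => hmul k ⟨Multiset.mem_toFinset.1 hk.1, Multiset.mem_toFinset.1 hk.2⟩⟩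
    · exact fun j hj => hQ j (Multiset.mem_toFinset.1 hj)
    · rw [hweight, ← hm, IntPartition.weight, Finset.card_def, Finset.card_def, Finset.filter_val,
        hval]
      push_cast
      rfl
    · rw [← Nat.cast_sum, hsum, hn]
  · rintro ⟨⟨hpos, hgap, hmul⟩, hQ, hm, hn⟩
    refine ⟨IntPartition.ofMultiset s.val fun a ha => (hpos a ha).1,
      ⟨⟨?_, ⟨s.nodup, hgap, hmul⟩, ?_⟩, hQ⟩, ?_⟩
    · rw [← hn, ← Nat.cast_sum, Finset.sum_eq_multiset_sum, Multiset.map_id']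
      rfl
    · rw [← hm, hweight, IntPartition.weight, Finset.card_def, Finset.card_def, Finset.filter_val]
      push_cast
      rfl
    · exact s.val_toFinset

theorem encard_schurD (m n : ℤ) (N : ℕ) (hN : n ≤ N) :
    (schurD m n).encard = schurCount (fun _ => True) N m n := by
  rw [← encard_schurD_sep _ _ _ _ hN]
  simp

theorem encard_schurDStar (m n : ℤ) (N : ℕ) (hN : n ≤ N) :
    (schurDStar m n).encard = schurCount IsStarPart N m n := by
  rw [← encard_schurD_sep _ _ _ _ hN]
  congr 1
  ext π
  simp only [schurDStar, Set.mem_ofPred_eq]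
  refine and_congr_right fun _ => ?_
  constructor
  · rintro ⟨h1, h2⟩ a ha
    have h1 := h1 a ha
    have h2 := h2 a ha
    refine ⟨?_, ?_, ?_⟩ <;> rintro rfl
    · simpa using h1 (by decide)
    · simpa using h2 (by decide)
    · simpa using h2 (by decide)
  · intro h
    have hstar : ∀ a ∈ π.2.parts, 0 < a ∧ a ≠ 1 ∧ a ≠ 2 ∧ a ≠ 4 :=
      fun a ha => ⟨π.2.parts_pos ha, h a ha⟩
    refine ⟨fun a ha hodd => ?_, fun a ha heven => ?_⟩
    · have := hstar a ha
      obtain ⟨r, hr⟩ := hodd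
      omega
    · have := hstar a ha
      obtain ⟨r, hr⟩ := heven
      omega

theorem encard_schurDStar_eq (m n : ℤ) :
    (schurDStar m n).encard = (schurD m (n - 2 * m)).encard := by
  set k := n.toNat + (n - 2 * m).toNat + 1 with hk
  rw [encard_schurDStar m n (6 * k + 2) (by omega), encard_schurD _ _ (6 * k - 1) (by omega),
    schurCount_star_eq]

theorem encard_schurD_eq (m n : ℤ) :
    (schurD m n).encard = (schurDStar m n).encard + (schurDStar (m - 1) (n - 1)).encard +
      (schurDStar (m - 2) (n - 2)).encard := by
  set N := n.toNat + 4 with hN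
  rw [encard_schurD m n N (by omega), encard_schurDStar m n N (by omega),
    encard_schurDStar _ _ N (by omega), encard_schurDStar _ _ N (by omega),
    schurCount_eq_star_add N (by omega)]
  push_cast
  rfl

/-! ### The same two relations for odd parts -/

section Alladi

/-- The multisets of `m` odd numbers with sum `n` in which no number occurs more than twice. -/
def oddMultisets (m n : ℤ) : Set (Multiset ℕ) :=
  {t | (t.sum : ℤ) = n ∧ (∀ a ∈ t, Odd a) ∧ (∀ a, t.count a ≤ 2) ∧ (t.card : ℤ) = m}

/-- The members of `oddMultisets m n` not containing `1`. -/
def oddMultisetsStar (m n : ℤ) : Set (Multiset ℕ) :=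
  {t | t ∈ oddMultisets m n ∧ 1 ∉ t}

theorem encard_alladiCStar (m n : ℤ) :
    (alladiCStar m n).encard = (oddMultisetsStar m n).encard := by
  rw [← IntPartition.parts_injective.encard_image]
  congr 1
  ext t
  constructor
  · rintro ⟨π, ⟨⟨hn, ⟨hodd, hcount⟩, hm⟩, h1⟩, rfl⟩
    refine ⟨⟨?_, hodd, hcount, hm⟩, fun h => absurd (h1 1 h) (lt_irrefl 1)⟩
    rw [← hn]
    exact congrArg _ π.2.parts_sum
  · rintro ⟨⟨hn, hodd, hcount, hm⟩, h1⟩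
    refine ⟨IntPartition.ofMultiset t fun a ha => (hodd a ha).pos,
      ⟨⟨hn, ⟨hodd, hcount⟩, hm⟩, fun a ha => ?_⟩, rfl⟩
    have := (hodd a ha).pos
    have : a ≠ 1 := fun h => h1 (h ▸ ha)
    omega

theorem sum_map_add_two (t : Multiset ℕ) : (t.map (· + 2)).sum = t.sum + 2 * t.card := by
  rw [Multiset.sum_map_add, Multiset.map_id', Multiset.map_const', Multiset.sum_replicate,
    smul_eq_mul, mul_comm]

theorem encard_oddMultisetsStar_eq (m n : ℤ) :
    (oddMultisetsStar m n).encard = (oddMultisets m (n - 2 * m)).encard := by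
  have hinj : Function.Injective (· + 2 : ℕ → ℕ) := add_left_injective 2
  rw [← (Multiset.map_injective hinj).encard_image (oddMultisets m (n - 2 * m))]
  congr 1
  ext t
  constructor
  · rintro ⟨⟨hn, hodd, hcount, hm⟩, h1⟩
    -- Odd parts other than 1 are at least 3, so the subtraction does not truncate.
    have ht : (t.map (· - 2)).map (· + 2) = t := by
      rw [Multiset.map_map]
      conv_rhs => rw [← Multiset.map_id' t]
      refine Multiset.map_congr rfl fun a ha => ?_
      obtain ⟨r, hr⟩ := hodd a ha
      have : a ≠ 1 := fun h => h1 (h ▸ ha)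
      simp only [Function.comp_apply]
      omega
    refine ⟨t.map (· - 2), ⟨?_, ?_, ?_, ?_⟩, ht⟩
    · have h2 := sum_map_add_two (t.map (· - 2))
      rw [ht, Multiset.card_map] at h2
      omega
    · intro a ha
      obtain ⟨b, hb, rfl⟩ := Multiset.mem_map.1 ha
      obtain ⟨r, hr⟩ := hodd b hb
      have : b ≠ 1 := fun h => h1 (h ▸ hb)
      exact ⟨r - 1, by omega⟩
    · intro a
      rw [← Multiset.count_map_eq_count' _ _ hinj, ht]
      exact hcount _
    · rw [Multiset.card_map, hm]
  · rintro ⟨t, ⟨hn, hodd, hcount, hm⟩, rfl⟩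
    refine ⟨⟨?_, ?_, ?_, ?_⟩, ?_⟩
    · rw [sum_map_add_two]
      omega
    · intro a ha
      obtain ⟨b, hb, rfl⟩ := Multiset.mem_map.1 ha
      exact (hodd b hb).add_even even_two
    · intro a
      by_cases ha : a ∈ t.map (· + 2)
      · obtain ⟨b, hb, rfl⟩ := Multiset.mem_map.1 ha
        exact (Multiset.count_map_eq_count' _ _ hinj b).trans_le (hcount b)
      · rw [Multiset.count_eq_zero_of_notMem ha]
        omega
    · rw [Multiset.card_map, hm]
    · intro h
      obtain ⟨b, hb, h⟩ := Multiset.mem_map.1 h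
      omega

theorem encard_oddMultisets_count_one (m n : ℤ) (i : ℕ) (hi : i ≤ 2) :
    {t | t ∈ oddMultisets m n ∧ t.count 1 = i}.encard =
      (oddMultisetsStar (m - i) (n - i)).encard := by
  have hinj : Function.Injective (· + Multiset.replicate i 1 : Multiset ℕ → Multiset ℕ) :=
    add_left_injective _
  rw [← hinj.encard_image (oddMultisetsStar (m - i) (n - i))]
  congr 1
  ext t
  constructor
  · rintro ⟨⟨hn, hodd, hcount, hm⟩, h1⟩
    have ht : t.filter (· ≠ 1) + Multiset.replicate i 1 = t := by
      rw [← h1, ← Multiset.filter_eq', add_comm]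
      exact Multiset.filter_add_not _ t
    refine ⟨t.filter (· ≠ 1), ⟨⟨?_, ?_, ?_, ?_⟩, ?_⟩, ht⟩
    · have h2 := congrArg Multiset.sum ht
      rw [Multiset.sum_add, Multiset.sum_replicate, smul_eq_mul, mul_one] at h2
      omega
    · exact fun a ha => hodd a (Multiset.mem_of_mem_filter ha)
    · exact fun a => (Multiset.count_le_of_le a (Multiset.filter_le _ t)).trans (hcount a)
    · have h2 := congrArg Multiset.card ht
      rw [Multiset.card_add, Multiset.card_replicate] at h2
      omega
    · simp
  · rintro ⟨t, ⟨⟨hn, hodd, hcount, hm⟩, h1⟩, rfl⟩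
    have hc : (t + Multiset.replicate i 1).count 1 = i := by
      rw [Multiset.count_add, Multiset.count_eq_zero_of_notMem h1, Multiset.count_replicate_self,
        zero_add]
    refine ⟨⟨?_, ?_, ?_, ?_⟩, hc⟩
    · rw [Multiset.sum_add, Multiset.sum_replicate, smul_eq_mul, mul_one]
      omega
    · intro a ha
      rcases Multiset.mem_add.1 ha with ha | ha
      · exact hodd a ha
      · rw [Multiset.eq_of_mem_replicate ha]
        exact odd_one
    · intro a
      by_cases ha : a = 1
      · rw [ha]
        exact hc.trans_le hi
      · rw [Multiset.count_add, Multiset.count_replicate, if_neg (Ne.symm ha), add_zero]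
        exact hcount a
    · rw [Multiset.card_add, Multiset.card_replicate]
      push_cast
      linarith

theorem encard_oddMultisets_eq (m n : ℤ) :
    (oddMultisets m n).encard = (oddMultisetsStar m n).encard +
      (oddMultisetsStar (m - 1) (n - 1)).encard + (oddMultisetsStar (m - 2) (n - 2)).encard := by
  have h0 := encard_oddMultisets_count_one m n 0 (by omega)
  have h1 := encard_oddMultisets_count_one m n 1 (by omega)
  have h2 := encard_oddMultisets_count_one m n 2 (by omega)
  simp only [Nat.cast_zero, sub_zero, Nat.cast_one, Nat.cast_ofNat] at h0 h1 h2
  rw [← h0, ← h1, ← h2, ← Set.encard_union_eq, ← Set.encard_union_eq]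
  · congr 1
    ext t
    constructor
    · intro ht
      have := ht.2.2.1 1
      rcases (by omega : t.count 1 = 0 ∨ t.count 1 = 1 ∨ t.count 1 = 2) with h | h | h
      · exact Or.inl (Or.inl ⟨ht, h⟩)
      · exact Or.inl (Or.inr ⟨ht, h⟩)
      · exact Or.inr ⟨ht, h⟩
    · rintro ((ht | ht) | ht) <;> exact ht.1
  · rw [Set.disjoint_left]
    rintro t (⟨-, h⟩ | ⟨-, h⟩) ⟨-, h'⟩ <;> omega
  · rw [Set.disjoint_left]
    rintro t ⟨-, h⟩ ⟨-, h'⟩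
    omega

end Alladi

/-! ### Induction and conclusion -/

theorem schurD_eq_empty_of_neg {m n : ℤ} (h : m < 0 ∨ n < 0) : schurD m n = ∅ := by
  refine Set.eq_empty_of_forall_notMem ?_
  rintro π ⟨hn, -, hm⟩
  omega

theorem oddMultisets_eq_empty_of_neg {m n : ℤ} (h : m < 0 ∨ n < 0) : oddMultisets m n = ∅ := by
  refine Set.eq_empty_of_forall_notMem ?_
  rintro t ⟨hn, -, -, hm⟩
  omega

theorem schurD_zero_left (n : ℤ) :
    (schurD 0 n).encard = (oddMultisets 0 n).encard := by
  have hcard : ∀ π ∈ schurD 0 n, π.2.parts = 0 := by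
    rintro π ⟨-, -, hm⟩
    unfold IntPartition.weight at hm
    exact Multiset.card_eq_zero.1 (by omega)
  rw [← IntPartition.parts_injective.encard_image]
  congr 1
  ext t
  constructor
  · rintro ⟨π, hπ, rfl⟩
    have h := hcard π hπ
    have h2 := π.2.parts_sum
    dsimp only
    rw [h] at h2 ⊢
    refine ⟨?_, by simp, by simp, by simp⟩
    rw [h2, hπ.1]
  · rintro ⟨hn, -, -, hm⟩
    obtain rfl : t = 0 := Multiset.card_eq_zero.1 (by omega)
    refine ⟨IntPartition.ofMultiset 0 (by simp), ⟨hn, ⟨?_, ?_, ?_⟩, ?_⟩, rfl⟩ <;>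
      simp [IntPartition.ofMultiset, IntPartition.weight]

theorem encard_schurD_eq_oddMultisets (m n : ℤ) :
    (schurD m n).encard = (oddMultisets m n).encard := by
  obtain ⟨k, hk⟩ : ∃ k : ℕ, n < k := ⟨n.toNat + 1, by omega⟩
  induction k using Nat.strong_induction_on generalizing m n with
  | _ k ih =>
    by_cases hneg : m < 0 ∨ n < 0
    · rw [schurD_eq_empty_of_neg hneg, oddMultisets_eq_empty_of_neg hneg, Set.encard_empty,
        Set.encard_empty]
    · rcases eq_or_ne m 0 with rfl | hm
      · exact schurD_zero_left n
      -- After the shift the second index is n - i - 2(m - i), below `n` when the first alternative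
      -- holds. For m ≥ 1 and i ≤ 2 that fails only at m = 1, i = 2, where m - i < 0. At m = 0 the
      -- shift fixes `n`, hence the separate case.
      · have hstep : ∀ i : ℤ, 0 ≤ i → 0 < i + 2 * (m - i) ∨ m - i < 0 →
            (schurDStar (m - i) (n - i)).encard = (oddMultisetsStar (m - i) (n - i)).encard := by
          intro i hi h
          rw [encard_schurDStar_eq, encard_oddMultisetsStar_eq]
          rcases h with h | h
          · exact ih (k - 1) (by omega) _ _ (by omega)
          · rw [schurD_eq_empty_of_neg (Or.inl h), oddMultisets_eq_empty_of_neg (Or.inl h),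
              Set.encard_empty, Set.encard_empty]
        have h0 := hstep 0 (by omega) (by omega)
        rw [sub_zero, sub_zero] at h0
        rw [encard_schurD_eq, encard_oddMultisets_eq, h0, hstep 1 (by omega) (by omega),
          hstep 2 (by omega) (by omega)]

theorem theorem1 (m n : ℤ) :
    (schurDStar m n).encard = (alladiCStar m n).encard ∧
    (schurDStar m n).encard = (schurD m (n - 2 * m)).encard := by
  refine ⟨?_, encard_schurDStar_eq m n⟩
  rw [encard_schurDStar_eq, encard_alladiCStar, encard_oddMultisetsStar_eq,
    encard_schurD_eq_oddMultisets]
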